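/- Let $\mathbb D$ be the open unit disk, let $q\in\mathbb C$ with $\Re q>0$, and let $r>0$. Let $F$ be holomorphic in $\mathbb D$ with $F(0)=0$, $F'(0)=1+rq$ and $\Re\frac{1}{2r\Re q}\left(\frac{F(z)}{z}-(1+rq)\right)>-\frac12$ for $z\in\mathbb D\setminus\{0\}$ (equivalently, $F(z)=z+rf(z)$ with $f(z)=zp(z)$, where $p$ is holomorphic in $\mathbb D$, $\Re p>0$ and $p(0)=q$). Let $G_r=F^{-1}=(\mathrm{Id}+rf)^{-1}:\mathbb D\to\mathbb D$ be the resolvent, that is, the self-mapping of $\mathbb D$ satisfying $F(G_r(w))=w$ for all $w\in\mathbb D$. Put $$A(x)=\frac{6x(1+x)}{(1+x)^3-3(5x-1)},$$ let $r_0$ be the largest real root of the equation $A(x)=1$, and suppose that $r\Re q>r_0$. Write $A=A(r\Re q)$. A univalent (holomorphic and injective) function $h$ in $\mathbb D$ with $h(0)=0$ is called - starlike of order $\alpha\in(0,1)$ if $\Re\frac{zh'(z)}{h(z)}>\alpha$ for all $z\in\mathbb D$; - $\theta$-spirallike of order $\alpha\in(0,1)$ if $\Re\left(e^{-i\theta}\frac{zh'(z)}{h(z)}\right)>\alpha\cos\theta$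 for all $z\in\mathbb D$; - strongly starlike of order $\beta\in(0,1)$ if $\left|\arg\frac{zh'(z)}{h(z)}\right|<\frac{\pi\beta}{2}$ for all $z\in\mathbb D$, where $zh'(z)/h(z)$ is given its limit value $1$ at $z=0$. Then: 1. for every real $\theta$ with $|\theta|\le\arccos\frac{6}{r\Re q}$ (if $r\Re q<6$, the right-hand side is read as $0$, so that only $\theta=0$ is admitted), $G_r$ is $\theta$-spirallike of order $$\frac{\cos\theta-A}{(1-A^2)\cos\theta};$$ 2. $G_r$ is starlike of order $\frac{1}{1+A}$; 3. $G_r$ is strongly starlike of order $\frac2\pi\arcsin A$. In particular, these three numbers belong to $(0,1)$. -/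

import Mathlib

noncomputable section

namespace Resolvent

/-- The open unit disk. -/
def disk : Set ℂ := Metric.ball 0 1

/-- The function `z ↦ z h'(z) / h(z)`, with its removable singularity at the origin filled in:
for a univalent `h` with `h 0 = 0` the value there is `1`. -/
def starQuotient (h : ℂ → ℂ) (z : ℂ) : ℂ :=
  if z = 0 then 1 else z * deriv h z / h z

/-- `h` is a univalent (holomorphic and injective) function in the unit disk with `h 0 = 0`. -/
structure IsUnivalentZero (h : ℂ → ℂ) : Prop where
  holo : DifferentiableOn ℂ h disk
  inj : Set.InjOn h disk
  map_zero : h 0 = 0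

/-- `h` is starlike of order `α ∈ (0, 1)`. -/
structure IsStarlikeOfOrder (α : ℝ) (h : ℂ → ℂ) : Prop where
  univalent : IsUnivalentZero h
  order_mem : α ∈ Set.Ioo (0 : ℝ) 1
  lt_re : ∀ z ∈ disk, α < (starQuotient h z).re

/-- `h` is `θ`-spirallike of order `α ∈ (0, 1)`. -/
structure IsSpirallikeOfOrder (θ α : ℝ) (h : ℂ → ℂ) : Prop where
  univalent : IsUnivalentZero h
  order_mem : α ∈ Set.Ioo (0 : ℝ) 1
  lt_re : ∀ z ∈ disk,
    α * Real.cos θ < (Complex.exp (-(Complex.I * (θ : ℂ))) * starQuotient h z).re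

/-- `h` is strongly starlike of order `β ∈ (0, 1)`. -/
structure IsStronglyStarlikeOfOrder (β : ℝ) (h : ℂ → ℂ) : Prop where
  univalent : IsUnivalentZero h
  order_mem : β ∈ Set.Ioo (0 : ℝ) 1
  abs_arg_lt : ∀ z ∈ disk, |Complex.arg (starQuotient h z)| < Real.pi * β / 2

/-- The class of functions `F` holomorphic in the unit disk with `F 0 = 0`, `F' 0 = β` and
`Re ((F z / z - β) / α) > -1/2`. At `z = 0` the quotient `F z / z` means `F' 0 = β`, so the
inequality is trivially true there and is required for `z ≠ 0` only. -/
def classA (α β : ℂ) : Set (ℂ → ℂ) :=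
  {F | DifferentiableOn ℂ F disk ∧ F 0 = 0 ∧ deriv F 0 = β ∧
    ∀ z ∈ disk, z ≠ 0 → -(1 / 2 : ℝ) < (1 / α * (F z / z - β)).re}

/-- The resolvents `G_r = (Id + r f)⁻¹`, for generators `f` with `f 0 = 0` and `f' 0 = q`: the
self-mappings `G` of the unit disk that are right inverse there to some `F = Id + r f` in the
class `classA (2 r Re q) (1 + r q)`. Such a `G` is unique given `F`; its being holomorphic is
not part of the definition. -/
def resolvents (r : ℝ) (q : ℂ) : Set (ℂ → ℂ) :=
  {G | ∃ F ∈ classA ((2 * r * q.re : ℝ) : ℂ) (1 + (r : ℂ) * q),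
    Set.MapsTo G disk disk ∧ ∀ w ∈ disk, F (G w) = w}

/-- The function `A(x) = 6x(1+x) / ((1+x)³ - 3(5x-1))`. -/
def funA (x : ℝ) : ℝ := 6 * x * (1 + x) / ((1 + x) ^ 3 - 3 * (5 * x - 1))

/-- The largest real root of the equation `A(x) = 1` (see `isGreatest_r₀`). -/
def r₀ : ℝ := sSup {x : ℝ | funA x = 1}

theorem setOf_funA_eq_one :
    {x : ℝ | funA x = 1} = {x : ℝ | x ^ 3 - 3 * x ^ 2 - 18 * x + 4 = 0} := by
  ext x
  simp only [Set.mem_setOf_eq, funA]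
  constructor
  · intro h
    have hd : (1 + x) ^ 3 - 3 * (5 * x - 1) ≠ 0 := by
      intro h0
      rw [h0, div_zero] at h
      exact zero_ne_one h
    rw [div_eq_one_iff_eq hd] at h
    linarith
  · intro h
    have hd : (1 + x) ^ 3 - 3 * (5 * x - 1) ≠ 0 := by
      intro h0
      have h1 : x * (1 + x) = 0 := by linarith
      rcases mul_eq_zero.mp h1 with h2 | h2
      · subst h2; norm_num at h
      · have h3 : x = -1 := by linarith
        subst h3; norm_num at h
    rw [div_eq_one_iff_eq hd]
    linarith

theorem isGreatest_r₀ : IsGreatest {x : ℝ | funA x = 1} r₀ := by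
  unfold r₀
  rw [setOf_funA_eq_one]
  have hne : {x : ℝ | x ^ 3 - 3 * x ^ 2 - 18 * x + 4 = 0}.Nonempty := by
    have h := intermediate_value_Icc (a := (5 : ℝ)) (b := 6) (by norm_num)
      (f := fun x : ℝ => x ^ 3 - 3 * x ^ 2 - 18 * x + 4) (by fun_prop)
    obtain ⟨x, -, hx⟩ := h (show (0 : ℝ) ∈ _ by constructor <;> norm_num)
    exact ⟨x, hx⟩
  have hbdd : BddAbove {x : ℝ | x ^ 3 - 3 * x ^ 2 - 18 * x + 4 = 0} := by
    refine ⟨6, fun x hx => ?_⟩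
    simp only [Set.mem_setOf_eq] at hx
    by_contra! h
    nlinarith [mul_pos (show 0 < x by linarith) (show 0 < x - 6 by linarith),
      mul_pos (mul_pos (show 0 < x by linarith) (show 0 < x - 6 by linarith))
        (show 0 < x + 3 by linarith)]
  have hcl : IsClosed {x : ℝ | x ^ 3 - 3 * x ^ 2 - 18 * x + 4 = 0} :=
    isClosed_eq (by fun_prop) continuous_const
  exact ⟨hcl.csSup_mem hne hbdd, fun x hx => le_csSup hbdd hx⟩

end Resolvent

end

/-!
Write `F w = w * (1 + p w)`. The hypothesis on `F` says that `Re p > 0` in the disk, and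
`Re (p 0) = x` with `x = r * Re q`. The Schwarz lemma for maps into the right half-plane gives
Harnack's inequality for `Re p` and the bound `‖p' w‖ ≤ 2 * Re (p w) / (1 - ‖w‖)`. At a point
`w = G z` we have `‖w * (1 + p w)‖ = ‖z‖ < 1`, so Harnack's inequality forces `‖w‖ < 1 / (x - 1)`
and the derivative bound gives `‖w * p' w / (1 + p w)‖ ≤ 2 * ‖w‖`. The reciprocal of
`z * G' z / G z` is exactly `1 + w * p' w / (1 + p w)`, hence it lies in the disk of centre `1` and
radius `2 / (x - 1) ≤ A x`. Inverting that disk gives the disk of diameter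
`((1 + A)⁻¹, (1 - A)⁻¹)`, which is seen from the origin under the half-angle `arcsin A`.
-/

namespace Resolvent

open Metric Set Filter Topology
open scoped ComplexConjugate

section RightHalfPlane

theorem add_conj_ne_zero_of_re_pos {a b : ℂ} (ha : 0 < a.re) (hb : 0 < b.re) :
    a + conj b ≠ 0 := fun h => by
  have hre := congrArg Complex.re h
  simp only [Complex.add_re, Complex.conj_re, Complex.zero_re] at hre
  linarith

theorem sq_norm_add_conj_sub_sq_norm_sub (a b : ℂ) :
    ‖a + conj b‖ ^ 2 - ‖a - b‖ ^ 2 = 4 * a.re * b.re := by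
  simp only [Complex.sq_norm, Complex.normSq_apply, Complex.sub_re, Complex.sub_im,
    Complex.add_re, Complex.add_im, Complex.conj_re, Complex.conj_im]
  ring

theorem norm_sub_le_norm_add_conj {a b : ℂ} (ha : 0 ≤ a.re) (hb : 0 ≤ b.re) :
    ‖a - b‖ ≤ ‖a + conj b‖ := by
  rw [← sq_le_sq₀ (norm_nonneg _) (norm_nonneg _)]
  linarith [sq_norm_add_conj_sub_sq_norm_sub a b, mul_nonneg ha hb]

theorem norm_sub_le_mul_norm_add_conj {E : Type*} [NormedAddCommGroup E] [NormedSpace ℂ E]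
    {f : E → ℂ} {c z : E} {R : ℝ} (hf : DifferentiableOn ℂ f (ball c R))
    (hpos : ∀ z ∈ ball c R, 0 < (f z).re) (hz : z ∈ ball c R) :
    ‖f z - f c‖ ≤ dist z c / R * ‖f z + conj (f c)‖ := by
  have hc : 0 < (f c).re := hpos c (mem_ball_self (nonempty_ball.mp ⟨z, hz⟩))
  have hne : ∀ z ∈ ball c R, f z + conj (f c) ≠ 0 := fun z hz =>
    add_conj_ne_zero_of_re_pos (hpos z hz) hc
  let cayley : E → ℂ := fun z => (f z - f c) / (f z + conj (f c))
  have hcayley : DifferentiableOn ℂ cayley (ball c R) := by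
    simp only [cayley, div_eq_mul_inv]
    exact (hf.sub_const _).mul ((hf.add_const _).inv hne)
  have hcayley_c : cayley c = 0 := by simp [cayley]
  have hmaps : MapsTo cayley (ball c R) (closedBall (cayley c) 1) := fun z hz => by
    rw [hcayley_c, mem_closedBall_zero_iff, norm_div]
    exact div_le_one_of_le₀ (norm_sub_le_norm_add_conj (hpos z hz).le hc.le) (norm_nonneg _)
  have hschwarz := Complex.dist_le_div_mul_dist_of_mapsTo_ball hcayley hmaps hz
  rwa [hcayley_c, dist_zero_right, norm_div, div_le_iff₀ (norm_pos_iff.mpr (hne z hz)),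
    one_div_mul_eq_div] at hschwarz

theorem abs_re_sub_re_le_of_norm_sub_le {a b : ℂ} {t : ℝ} (ha : 0 ≤ a.re) (hb : 0 ≤ b.re)
    (ht0 : 0 ≤ t) (ht1 : t ≤ 1) (h : ‖a - b‖ ≤ t * ‖a + conj b‖) :
    |a.re - b.re| ≤ t * (a.re + b.re) := by
  have hsq : ‖a - b‖ ^ 2 ≤ t ^ 2 * ‖a + conj b‖ ^ 2 := by
    rw [← mul_pow]; gcongr
  simp only [Complex.sq_norm, Complex.normSq_apply, Complex.sub_re, Complex.sub_im,
    Complex.add_re, Complex.add_im, Complex.conj_re, Complex.conj_im] at hsq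
  have him : 0 ≤ (1 - t ^ 2) * (a.im - b.im) ^ 2 :=
    mul_nonneg (by nlinarith) (sq_nonneg _)
  exact abs_le_of_sq_le_sq (by linarith) (by positivity)

/-- A symmetric form of **Harnack's inequality**: with `t = dist z c / R` it says that
`(1 - t) / (1 + t) ≤ (f z).re / (f c).re ≤ (1 + t) / (1 - t)`. -/
theorem abs_re_sub_re_le_div_mul_add {E : Type*} [NormedAddCommGroup E] [NormedSpace ℂ E]
    {f : E → ℂ} {c z : E} {R : ℝ} (hf : DifferentiableOn ℂ f (ball c R))
    (hpos : ∀ z ∈ ball c R, 0 < (f z).re) (hz : z ∈ ball c R) :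
    |(f z).re - (f c).re| ≤ dist z c / R * ((f z).re + (f c).re) := by
  have hR : 0 < R := nonempty_ball.mp ⟨z, hz⟩
  exact abs_re_sub_re_le_of_norm_sub_le (hpos z hz).le (hpos c (mem_ball_self hR)).le
    (by positivity) (div_le_one_of_le₀ (mem_ball.mp hz).le hR.le)
    (norm_sub_le_mul_norm_add_conj hf hpos hz)

theorem norm_deriv_le_two_mul_re_div {f : ℂ → ℂ} {c : ℂ} {R : ℝ} (hR : 0 < R)
    (hf : DifferentiableOn ℂ f (ball c R)) (hpos : ∀ z ∈ ball c R, 0 < (f z).re) :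
    ‖deriv f c‖ ≤ 2 * (f c).re / R := by
  have hball : ball c R ∈ 𝓝 c := ball_mem_nhds c hR
  have hfc : DifferentiableAt ℂ f c := hf.differentiableAt hball
  have hslope : Tendsto (fun z => ‖slope f c z‖) (𝓝[≠] c) (𝓝 ‖deriv f c‖) :=
    (hasDerivAt_iff_tendsto_slope.mp hfc.hasDerivAt).norm
  have hbound : Tendsto (fun z => ‖f z + conj (f c)‖ / R) (𝓝[≠] c)
      (𝓝 (‖f c + conj (f c)‖ / R)) :=
    ((hfc.continuousAt.add_const _).norm.div_const R).tendsto.mono_left nhdsWithin_le_nhds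
  have hnorm : ‖f c + conj (f c)‖ = 2 * (f c).re := by
    rw [Complex.add_conj, Complex.norm_real,
      Real.norm_of_nonneg (mul_nonneg two_pos.le (hpos c (mem_ball_self hR)).le)]
  rw [← hnorm]
  refine le_of_tendsto_of_tendsto hslope hbound ?_
  filter_upwards [self_mem_nhdsWithin, nhdsWithin_le_nhds hball] with z hne hz
  rw [slope_def_field, norm_div, div_le_iff₀ (norm_pos_iff.mpr (sub_ne_zero.mpr hne)),
    ← dist_eq_norm z c, div_mul_eq_mul_div, mul_comm, ← div_mul_eq_mul_div]
  exact norm_sub_le_mul_norm_add_conj hf hpos hz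

end RightHalfPlane

theorem isOpen_disk : IsOpen disk := isOpen_ball

theorem mem_disk_iff {z : ℂ} : z ∈ disk ↔ ‖z‖ < 1 := mem_ball_zero_iff

theorem zero_mem_disk : (0 : ℂ) ∈ disk := mem_ball_self one_pos

/-- A Carathéodory function: a holomorphic function with positive real part in the unit disk. Such
`p` are the factors of the generators `f w = w * p w`, so the value at the origin is not
normalized. -/
structure IsCaratheodory (p : ℂ → ℂ) : Prop where
  holo : DifferentiableOn ℂ p disk
  re_pos : ∀ z ∈ disk, 0 < (p z).re

namespace IsCaratheodory

variable {p : ℂ → ℂ} {w : ℂ}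

theorem differentiableAt (hp : IsCaratheodory p) (hw : w ∈ disk) : DifferentiableAt ℂ p w :=
  hp.holo.differentiableAt (isOpen_disk.mem_nhds hw)

theorem one_lt_norm_one_add (hp : IsCaratheodory p) (hw : w ∈ disk) : 1 < ‖1 + p w‖ :=
  calc 1 < (1 + p w).re := by simpa using hp.re_pos w hw
    _ ≤ ‖1 + p w‖ := Complex.re_le_norm _

theorem one_add_ne_zero (hp : IsCaratheodory p) (hw : w ∈ disk) : 1 + p w ≠ 0 :=
  norm_pos_iff.mp (one_pos.trans (hp.one_lt_norm_one_add hw))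

theorem norm_deriv_le (hp : IsCaratheodory p) (hw : w ∈ disk) :
    ‖deriv p w‖ ≤ 2 * (p w).re / (1 - ‖w‖) := by
  have hsub : ball w (1 - ‖w‖) ⊆ disk := ball_subset_ball' (by simp)
  exact norm_deriv_le_two_mul_re_div (sub_pos.mpr (mem_disk_iff.mp hw)) (hp.holo.mono hsub)
    fun z hz => hp.re_pos z (hsub hz)

theorem norm_mul_re_sub_one_lt_one (hp : IsCaratheodory p) (hw : w ∈ disk)
    (hF : ‖w * (1 + p w)‖ < 1) : ‖w‖ * ((p 0).re - 1) < 1 := by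
  have ht : ‖w‖ < 1 := mem_disk_iff.mp hw
  have hharnack : (p 0).re - (p w).re ≤ ‖w‖ * ((p w).re + (p 0).re) := by
    have habs := abs_re_sub_re_le_div_mul_add hp.holo hp.re_pos hw
    rw [dist_zero_right, div_one] at habs
    linarith [neg_le_of_abs_le habs]
  have hre : ‖w‖ * (1 + (p w).re) < 1 := by
    rw [norm_mul] at hF
    refine (mul_le_mul_of_nonneg_left ?_ (norm_nonneg w)).trans_lt hF
    simpa using Complex.re_le_norm (1 + p w)
  have hprod : 0 < (1 - ‖w‖) * (1 - ‖w‖ * ((p 0).re - 1)) := by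
    nlinarith [mul_le_mul_of_nonneg_left hharnack (norm_nonneg w), norm_nonneg w]
  linarith [pos_of_mul_pos_right hprod (by linarith)]

theorem norm_mul_deriv_div_le (hp : IsCaratheodory p) (hw : w ∈ disk)
    (hF : ‖w * (1 + p w)‖ < 1) : ‖w * deriv p w / (1 + p w)‖ ≤ 2 * ‖w‖ := by
  have ht : ‖w‖ < 1 := mem_disk_iff.mp hw
  have hre : 1 + (p w).re ≤ ‖1 + p w‖ := by simpa using Complex.re_le_norm (1 + p w)
  have hderiv : ‖deriv p w‖ ≤ 2 * ‖1 + p w‖ := by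
    refine (hp.norm_deriv_le hw).trans ?_
    rw [div_le_iff₀ (by linarith)]
    rw [norm_mul] at hF
    linarith
  rw [norm_div, norm_mul, div_le_iff₀ (one_pos.trans (hp.one_lt_norm_one_add hw))]
  linarith [mul_le_mul_of_nonneg_left hderiv (norm_nonneg w)]

theorem norm_deriv_inv_one_add_le (hp : IsCaratheodory p) (hw : w ∈ disk) :
    ‖deriv (fun z => (1 + p z)⁻¹) w‖ ≤ 1 / (2 * (1 - ‖w‖)) := by
  have ht : 0 < 1 - ‖w‖ := sub_pos.mpr (mem_disk_iff.mp hw)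
  have hre : 1 + (p w).re ≤ ‖1 + p w‖ := by simpa using Complex.re_le_norm (1 + p w)
  have hpos := one_pos.trans (hp.one_lt_norm_one_add hw)
  have hderiv := ((hp.differentiableAt hw).hasDerivAt.const_add 1).fun_inv
    (hp.one_add_ne_zero hw)
  rw [hderiv.deriv, norm_div, norm_neg, norm_pow, div_le_iff₀ (by positivity)]
  calc ‖deriv p w‖ ≤ 2 * (p w).re / (1 - ‖w‖) := hp.norm_deriv_le hw
    _ ≤ (‖1 + p w‖ ^ 2 / 2) / (1 - ‖w‖) := by
      gcongr
      nlinarith [sq_nonneg (‖1 + p w‖ - 2)]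
    _ = 1 / (2 * (1 - ‖w‖)) * ‖1 + p w‖ ^ 2 := by field_simp

/-- A solution of `w * (1 + p w) = z` is a fixed point of `z * (1 + p ·)⁻¹`, which contracts
distances on the ball of radius `1 / 2` when `‖z‖ < 1`. -/
theorem injOn_mul_one_add (hp : IsCaratheodory p) :
    InjOn (fun w => w * (1 + p w)) {w ∈ ball (0 : ℂ) (1 / 2) | ‖w * (1 + p w)‖ < 1} := by
  rintro a ⟨ha, haF⟩ b ⟨hb, -⟩ (hab : a * (1 + p a) = b * (1 + p b))
  have hsub : ball (0 : ℂ) (1 / 2) ⊆ disk := ball_subset_ball (by norm_num)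
  have hlip : ‖(1 + p a)⁻¹ - (1 + p b)⁻¹‖ ≤ 1 * ‖a - b‖ := by
    refine Convex.norm_image_sub_le_of_norm_deriv_le (𝕜 := ℂ) (f := fun z => (1 + p z)⁻¹)
      (fun w hw => ((hp.differentiableAt (hsub hw)).const_add 1).inv
        (hp.one_add_ne_zero (hsub hw)))
      (fun w hw => (hp.norm_deriv_inv_one_add_le (hsub hw)).trans ?_) (convex_ball _ _) hb ha
    have hw' := mem_ball_zero_iff.mp hw
    exact div_le_one_of_le₀ (by linarith) (by linarith)
  have hsub_eq : a - b = a * (1 + p a) * ((1 + p a)⁻¹ - (1 + p b)⁻¹) := by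
    rw [mul_sub, mul_inv_cancel_right₀ (hp.one_add_ne_zero (hsub ha)), hab,
      mul_inv_cancel_right₀ (hp.one_add_ne_zero (hsub hb))]
  by_contra hne
  have hpos : 0 < ‖a - b‖ := norm_pos_iff.mpr (sub_ne_zero.mpr hne)
  have hlt : ‖a - b‖ < ‖a - b‖ :=
    calc ‖a - b‖ = ‖a * (1 + p a)‖ * ‖(1 + p a)⁻¹ - (1 + p b)⁻¹‖ := by rw [← norm_mul, ← hsub_eq]
      _ ≤ ‖a * (1 + p a)‖ * ‖a - b‖ := by rw [one_mul] at hlip; gcongr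
      _ < ‖a - b‖ := mul_lt_of_lt_one_left hpos haF
  exact hlt.false

theorem hasDerivAt_mul_one_add (hp : IsCaratheodory p) (hw : w ∈ disk) :
    HasDerivAt (fun w => w * (1 + p w)) (1 + p w + w * deriv p w) w := by
  simpa using (hasDerivAt_id' w).fun_mul ((hp.differentiableAt hw).hasDerivAt.const_add 1)

end IsCaratheodory

/-- `G` is the resolvent `(Id + f)⁻¹` of the generator `f w = w * p w`: a self-mapping of the unit
disk that is right inverse to `Id + f`. The parameter `r` of the resolvent is absorbed in `p`. -/
structure IsResolvent (p G : ℂ → ℂ) : Prop where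
  mapsTo : MapsTo G disk disk
  mul_one_add : ∀ z ∈ disk, G z * (1 + p (G z)) = z

namespace IsResolvent

variable {p G : ℂ → ℂ} {z : ℂ}

theorem norm_mul_one_add_lt_one (hG : IsResolvent p G) (hz : z ∈ disk) :
    ‖G z * (1 + p (G z))‖ < 1 := by
  rwa [hG.mul_one_add z hz, ← mem_disk_iff]

theorem injOn (hG : IsResolvent p G) : InjOn G disk := fun a ha b hb hab => by
  rw [← hG.mul_one_add a ha, ← hG.mul_one_add b hb, hab]

theorem eq_zero_iff (hG : IsResolvent p G) (hp : IsCaratheodory p) (hz : z ∈ disk) :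
    G z = 0 ↔ z = 0 := by
  conv_rhs => rw [← hG.mul_one_add z hz, mul_eq_zero]
  exact (or_iff_left (hp.one_add_ne_zero (hG.mapsTo hz))).symm

theorem norm_lt_half (hG : IsResolvent p G) (hp : IsCaratheodory p) (hp0 : 3 ≤ (p 0).re)
    (hz : z ∈ disk) : ‖G z‖ < 1 / 2 := by
  have hlt := hp.norm_mul_re_sub_one_lt_one (hG.mapsTo hz) (hG.norm_mul_one_add_lt_one hz)
  nlinarith [norm_nonneg (G z)]

theorem deriv_mul_one_add_ne_zero (hG : IsResolvent p G) (hp : IsCaratheodory p)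
    (hp0 : 3 ≤ (p 0).re) (hz : z ∈ disk) : 1 + p (G z) + G z * deriv p (G z) ≠ 0 := fun h => by
  have hne := hp.one_add_ne_zero (hG.mapsTo hz)
  have hneg_one : G z * deriv p (G z) / (1 + p (G z)) = -1 := by
    rw [div_eq_iff hne]
    linear_combination h
  have hle := hp.norm_mul_deriv_div_le (hG.mapsTo hz) (hG.norm_mul_one_add_lt_one hz)
  rw [hneg_one, norm_neg, norm_one] at hle
  linarith [hG.norm_lt_half hp hp0 hz]

theorem eventually_leftInverse (hG : IsResolvent p G) (hp : IsCaratheodory p)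
    (hp0 : 3 ≤ (p 0).re) (hz : z ∈ disk) : ∀ᶠ w in 𝓝 (G z), G (w * (1 + p w)) = w := by
  have hGz : G z ∈ ball (0 : ℂ) (1 / 2) := mem_ball_zero_iff.mpr (hG.norm_lt_half hp hp0 hz)
  have hFdisk : ∀ᶠ w in 𝓝 (G z), w * (1 + p w) ∈ disk :=
    (hp.hasDerivAt_mul_one_add (hG.mapsTo hz)).continuousAt.eventually_mem
      (isOpen_disk.mem_nhds (by rwa [hG.mul_one_add z hz]))
  filter_upwards [isOpen_ball.mem_nhds hGz, hFdisk] with w hw hFw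
  exact hp.injOn_mul_one_add
    ⟨mem_ball_zero_iff.mpr (hG.norm_lt_half hp hp0 hFw), hG.norm_mul_one_add_lt_one hFw⟩
    ⟨hw, mem_disk_iff.mp hFw⟩ (hG.mul_one_add _ hFw)

theorem hasDerivAt (hG : IsResolvent p G) (hp : IsCaratheodory p) (hp0 : 3 ≤ (p 0).re)
    (hz : z ∈ disk) : HasDerivAt G (1 + p (G z) + G z * deriv p (G z))⁻¹ z := by
  have hw := hG.mapsTo hz
  have hstrict : HasStrictDerivAt (fun w => w * (1 + p w))
      (1 + p (G z) + G z * deriv p (G z)) (G z) := by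
    rw [← (hp.hasDerivAt_mul_one_add hw).deriv]
    exact ((differentiableOn_id.mul (hp.holo.const_add 1)).analyticAt
      (isOpen_disk.mem_nhds hw)).hasStrictDerivAt
  have hinv := hstrict.to_local_left_inverse (hG.deriv_mul_one_add_ne_zero hp hp0 hz)
    (hG.eventually_leftInverse hp hp0 hz)
  simpa only [hG.mul_one_add z hz] using hinv.hasDerivAt

theorem isUnivalentZero (hG : IsResolvent p G) (hp : IsCaratheodory p) (hp0 : 3 ≤ (p 0).re) :
    IsUnivalentZero G where
  holo _ hz := (hG.hasDerivAt hp hp0 hz).differentiableAt.differentiableWithinAt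
  inj := hG.injOn
  map_zero := (hG.eq_zero_iff hp zero_mem_disk).mpr rfl

theorem inv_starQuotient_sub_one (hG : IsResolvent p G) (hp : IsCaratheodory p)
    (hp0 : 3 ≤ (p 0).re) (hz : z ∈ disk) :
    (starQuotient G z)⁻¹ - 1 = G z * deriv p (G z) / (1 + p (G z)) := by
  rcases eq_or_ne z 0 with rfl | hz0
  · simp [starQuotient, (hG.eq_zero_iff hp hz).mpr rfl]
  · have hGz : G z ≠ 0 := (hG.eq_zero_iff hp hz).not.mpr hz0
    have hne := hp.one_add_ne_zero (hG.mapsTo hz)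
    have hquot : z / G z = 1 + p (G z) := by
      rw [div_eq_iff hGz, mul_comm, hG.mul_one_add z hz]
    rw [starQuotient, if_neg hz0, (hG.hasDerivAt hp hp0 hz).deriv, mul_div_right_comm, hquot,
      mul_inv, inv_inv]
    field_simp
    ring

theorem norm_inv_starQuotient_sub_one_lt (hG : IsResolvent p G) (hp : IsCaratheodory p)
    (hp0 : 3 ≤ (p 0).re) (hz : z ∈ disk) :
    ‖(starQuotient G z)⁻¹ - 1‖ < 2 / ((p 0).re - 1) := by
  have hF := hG.norm_mul_one_add_lt_one hz
  rw [hG.inv_starQuotient_sub_one hp hp0 hz, lt_div_iff₀ (by linarith)]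
  calc ‖G z * deriv p (G z) / (1 + p (G z))‖ * ((p 0).re - 1)
      ≤ 2 * ‖G z‖ * ((p 0).re - 1) :=
        mul_le_mul_of_nonneg_right (hp.norm_mul_deriv_div_le (hG.mapsTo hz) hF) (by linarith)
    _ < 2 := by linarith [hp.norm_mul_re_sub_one_lt_one (hG.mapsTo hz) hF]

end IsResolvent

theorem exists_isCaratheodory_of_mem_classA {F : ℂ → ℂ} {β : ℂ} {x : ℝ} (hx : 0 < x)
    (hβ : β.re = 1 + x) (hF : F ∈ classA ((2 * x : ℝ) : ℂ) β) :
    ∃ p : ℂ → ℂ, IsCaratheodory p ∧ p 0 = β - 1 ∧ ∀ w, F w = w * (1 + p w) := by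
  obtain ⟨hdiff, hF0, hderiv, hre⟩ := hF
  have hdslope0 : dslope F 0 0 = β := by rw [dslope_same, hderiv]
  refine ⟨fun w => dslope F 0 w - 1, ⟨?_, fun z hz => ?_⟩, by simp only [hdslope0], fun w => ?_⟩
  · exact ((Complex.differentiableOn_dslope (isOpen_disk.mem_nhds zero_mem_disk)).mpr
      hdiff).sub_const 1
  · rw [Complex.sub_re, Complex.one_re]
    rcases eq_or_ne z 0 with rfl | hz0
    · linarith [congrArg Complex.re hdslope0]
    · have hlt := hre z hz hz0
      rw [one_div ((2 * x : ℝ) : ℂ), ← Complex.ofReal_inv, Complex.re_ofReal_mul, Complex.sub_re,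
        hβ, inv_mul_eq_div, lt_div_iff₀ (by positivity)] at hlt
      rw [dslope_of_ne _ hz0, slope_def_field, hF0, sub_zero, sub_zero]
      linarith
  · simpa [hF0] using (sub_smul_dslope F 0 w).symm

theorem exists_isResolvent_of_mem_resolvents {r : ℝ} {q : ℂ} {G : ℂ → ℂ} (hx : 0 < r * q.re)
    (hG : G ∈ resolvents r q) :
    ∃ p : ℂ → ℂ, IsCaratheodory p ∧ p 0 = r * q ∧ IsResolvent p G := by
  obtain ⟨F, hF, hmaps, hFG⟩ := hG
  obtain ⟨p, hp, hp0, hFp⟩ := exists_isCaratheodory_of_mem_classA (β := 1 + r * q) hx (by simp)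
    (by rwa [← mul_assoc])
  exact ⟨p, hp, by rw [hp0, add_sub_cancel_left], hmaps, fun z hz => by rw [← hFp, hFG z hz]⟩

section InvertedDisk

variable {A : ℝ} {v : ℂ}

theorem one_sub_sq_mul_sq_norm_add_one_lt (hA : A ≤ 1) (hv : ‖v⁻¹ - 1‖ < A) :
    (1 - A ^ 2) * ‖v‖ ^ 2 + 1 < 2 * v.re := by
  have hv0 : v ≠ 0 := by
    rintro rfl
    rw [inv_zero, zero_sub, norm_neg, norm_one] at hv
    linarith
  have hnorm : ‖1 - v‖ < A * ‖v‖ := by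
    rw [← div_lt_iff₀ (norm_pos_iff.mpr hv0), ← norm_div, sub_div, div_self hv0, one_div]
    exact hv
  have hsq : ‖1 - v‖ ^ 2 < A ^ 2 * ‖v‖ ^ 2 := by
    rw [← mul_pow]; gcongr
  simp only [Complex.sq_norm, Complex.normSq_apply, Complex.sub_re, Complex.sub_im,
    Complex.one_re, Complex.one_im] at hsq ⊢
  linarith

theorem norm_one_sub_sq_mul_sub_one_lt (hA : A < 1) (hv : ‖v⁻¹ - 1‖ < A) :
    ‖((1 - A ^ 2 : ℝ) : ℂ) * v - 1‖ < A := by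
  have hA0 : 0 < A := (norm_nonneg _).trans_lt hv
  have hpos : 0 < (1 - A ^ 2) * (2 * v.re - ((1 - A ^ 2) * ‖v‖ ^ 2 + 1)) :=
    mul_pos (by nlinarith) (sub_pos.mpr (one_sub_sq_mul_sq_norm_add_one_lt hA.le hv))
  rw [← sq_lt_sq₀ (norm_nonneg _) hA0.le]
  simp only [Complex.sq_norm, Complex.normSq_apply, Complex.sub_re, Complex.sub_im,
    Complex.re_ofReal_mul, Complex.im_ofReal_mul, Complex.one_re, Complex.one_im] at hpos ⊢
  linarith

theorem div_one_sub_sq_lt_re_mul {e : ℂ} (he : ‖e‖ = 1) (hA : A < 1) (hv : ‖v⁻¹ - 1‖ < A) :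
    (e.re - A) / (1 - A ^ 2) < (e * v).re := by
  have hA0 : 0 < A := (norm_nonneg _).trans_lt hv
  have hlt : |(e * (((1 - A ^ 2 : ℝ) : ℂ) * v - 1)).re| < A := by
    refine (Complex.abs_re_le_norm _).trans_lt ?_
    rw [norm_mul, he, one_mul]
    exact norm_one_sub_sq_mul_sub_one_lt hA hv
  rw [mul_sub, mul_one, mul_left_comm, Complex.sub_re, Complex.re_ofReal_mul] at hlt
  rw [div_lt_iff₀ (by nlinarith)]
  linarith [neg_lt_of_abs_lt hlt]

theorem abs_arg_lt_arcsin (hA : A ≤ 1) (hv : ‖v⁻¹ - 1‖ < A) : |v.arg| < Real.arcsin A := by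
  have hA0 : 0 < A := (norm_nonneg _).trans_lt hv
  have hlt := one_sub_sq_mul_sq_norm_add_one_lt hA hv
  have hcoef : 0 ≤ (1 - A ^ 2) * ‖v‖ ^ 2 := mul_nonneg (by nlinarith) (sq_nonneg _)
  have hre : 0 < v.re := by linarith
  have hnorm : 0 < ‖v‖ := hre.trans_le (Complex.re_le_norm v)
  have hre_sq : (1 - A ^ 2) * ‖v‖ ^ 2 < v.re ^ 2 := by
    have hsq : ((1 - A ^ 2) * ‖v‖ ^ 2 + 1) ^ 2 < (2 * v.re) ^ 2 := by gcongr
    linarith [sq_nonneg ((1 - A ^ 2) * ‖v‖ ^ 2 - 1)]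
  have him : |v.im / ‖v‖| < A := by
    rw [abs_div, abs_norm, div_lt_iff₀ hnorm, ← sq_lt_sq₀ (abs_nonneg _) (by positivity), sq_abs,
      mul_pow]
    have hnorm_sq : ‖v‖ ^ 2 = v.re ^ 2 + v.im ^ 2 := by
      rw [Complex.sq_norm, Complex.normSq_apply]; ring
    linarith
  obtain ⟨hneg, hpos⟩ := abs_lt.mp him
  rw [Complex.arg_of_re_nonneg hre.le, abs_lt, ← Real.arcsin_neg]
  exact ⟨Real.arcsin_lt_arcsin (by linarith) hneg (by linarith),
    Real.arcsin_lt_arcsin (by linarith) hpos hA⟩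

end InvertedDisk

namespace IsUnivalentZero

variable {A : ℝ} {h : ℂ → ℂ}

theorem isSpirallikeOfOrder (hh : IsUnivalentZero h) (hA : A < 1)
    (hq : ∀ z ∈ disk, ‖(starQuotient h z)⁻¹ - 1‖ < A) {θ : ℝ} (hθ : A < Real.cos θ) :
    IsSpirallikeOfOrder θ ((Real.cos θ - A) / ((1 - A ^ 2) * Real.cos θ)) h := by
  have hA0 : 0 < A := (norm_nonneg _).trans_lt (hq 0 zero_mem_disk)
  have hcos : 0 < Real.cos θ := hA0.trans hθ
  have hden : 0 < (1 - A ^ 2) * Real.cos θ := mul_pos (by nlinarith) hcos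
  refine ⟨hh, ⟨div_pos (sub_pos.mpr hθ) hden, ?_⟩, fun z hz => ?_⟩
  · rw [div_lt_one hden]
    nlinarith [Real.cos_le_one θ]
  · have hexp : Complex.exp (-(Complex.I * θ)) = Complex.exp ((-θ : ℝ) * Complex.I) := by
      rw [Complex.ofReal_neg, neg_mul, mul_comm]
    have hlt := div_one_sub_sq_lt_re_mul (Complex.norm_exp_ofReal_mul_I (-θ)) hA (hq z hz)
    rwa [Complex.exp_ofReal_mul_I_re, Real.cos_neg, ← hexp,
      ← div_mul_cancel₀ ((Real.cos θ - A) / (1 - A ^ 2)) hcos.ne', div_div] at hlt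

theorem isStarlikeOfOrder (hh : IsUnivalentZero h) (hA : A < 1)
    (hq : ∀ z ∈ disk, ‖(starQuotient h z)⁻¹ - 1‖ < A) : IsStarlikeOfOrder (1 / (1 + A)) h := by
  have hA0 : 0 < A := (norm_nonneg _).trans_lt (hq 0 zero_mem_disk)
  refine ⟨hh, ⟨by positivity, (div_lt_one (by positivity)).mpr (by linarith)⟩, fun z hz => ?_⟩
  have horder : 1 / (1 + A) = (1 - A) / (1 - A ^ 2) := by
    rw [div_eq_div_iff (by positivity) (by nlinarith)]
    ring
  simpa [horder] using div_one_sub_sq_lt_re_mul norm_one hA (hq z hz)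

theorem isStronglyStarlikeOfOrder (hh : IsUnivalentZero h) (hA : A < 1)
    (hq : ∀ z ∈ disk, ‖(starQuotient h z)⁻¹ - 1‖ < A) :
    IsStronglyStarlikeOfOrder (2 / Real.pi * Real.arcsin A) h := by
  have hA0 : 0 < A := (norm_nonneg _).trans_lt (hq 0 zero_mem_disk)
  refine ⟨hh, ⟨mul_pos (by positivity) (Real.arcsin_pos.mpr hA0), ?_⟩, fun z hz => ?_⟩
  · rw [div_mul_eq_mul_div, div_lt_one Real.pi_pos]
    linarith [Real.arcsin_lt_pi_div_two.mpr hA]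
  · have hangle : Real.pi * (2 / Real.pi * Real.arcsin A) / 2 = Real.arcsin A := by field_simp
    rw [hangle]
    exact abs_arg_lt_arcsin hA.le (hq z hz)

end IsUnivalentZero

section FunA

variable {x : ℝ}

theorem funA_eq_one_iff : funA x = 1 ↔ x ^ 3 - 3 * x ^ 2 - 18 * x + 4 = 0 :=
  Set.ext_iff.mp setOf_funA_eq_one x

theorem five_le_r₀ : 5 ≤ r₀ := by
  obtain ⟨x, hx, hroot⟩ := intermediate_value_Icc (a := (5 : ℝ)) (b := 6) (by norm_num)
    (f := fun x : ℝ => x ^ 3 - 3 * x ^ 2 - 18 * x + 4) (by fun_prop)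
    (show (0 : ℝ) ∈ _ by constructor <;> norm_num)
  exact hx.1.trans (isGreatest_r₀.2 (funA_eq_one_iff.mpr hroot))

theorem cubic_pos_of_r₀_lt (hx : r₀ < x) : 0 < x ^ 3 - 3 * x ^ 2 - 18 * x + 4 := by
  have h5 := five_le_r₀
  have hroot : r₀ ^ 3 - 3 * r₀ ^ 2 - 18 * r₀ + 4 = 0 := funA_eq_one_iff.mp isGreatest_r₀.1
  have hfactor : 0 < (x - r₀) * (x ^ 2 + x * r₀ + r₀ ^ 2 - 3 * (x + r₀) - 18) :=
    mul_pos (sub_pos.mpr hx) (by nlinarith)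
  linarith

theorem funA_denom_pos (hx : 2 < x) : 0 < (1 + x) ^ 3 - 3 * (5 * x - 1) := by
  have hfactor : 0 < (x - 2) * (x ^ 2 + 5 * x - 2) := mul_pos (sub_pos.mpr hx) (by nlinarith)
  linarith

theorem funA_lt_one (hx : r₀ < x) : funA x < 1 := by
  rw [funA, div_lt_one (funA_denom_pos (by linarith [five_le_r₀]))]
  linarith [cubic_pos_of_r₀_lt hx]

theorem two_div_sub_one_le_funA (hx : 2 < x) : 2 / (x - 1) ≤ funA x := by
  rw [funA, div_le_div_iff₀ (by linarith) (funA_denom_pos hx)]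
  nlinarith [mul_nonneg (sub_nonneg.mpr hx.le) (sq_nonneg x)]

theorem funA_lt_six_div (hx : 6 ≤ x) : funA x < 6 / x := by
  rw [funA, div_lt_div_iff₀ (funA_denom_pos (by linarith)) (by linarith)]
  nlinarith

theorem funA_lt_cos {θ : ℝ} (hx : r₀ < x) (hθ : |θ| ≤ Real.arccos (6 / x)) :
    funA x < Real.cos θ := by
  have hx0 : 0 < x := by linarith [five_le_r₀]
  rcases le_total 6 x with h6 | h6
  · calc funA x < 6 / x := funA_lt_six_div h6
      _ = Real.cos (Real.arccos (6 / x)) :=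
        (Real.cos_arccos (neg_one_lt_zero.le.trans (by positivity))
          (div_le_one_of_le₀ h6 hx0.le)).symm
      _ ≤ Real.cos |θ| :=
        Real.cos_le_cos_of_nonneg_of_le_pi (abs_nonneg _) (Real.arccos_le_pi _) hθ
      _ = Real.cos θ := Real.cos_abs θ
  · rw [Real.arccos_of_one_le ((one_le_div hx0).mpr h6)] at hθ
    rw [abs_nonpos_iff.mp hθ, Real.cos_zero]
    exact funA_lt_one hx

end FunA

end Resolvent

theorem mainTheorem3_general {q : ℂ} {r A : ℝ} {G : ℂ → ℂ} (hx : 1 < r * q.re)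
    (hxA : 2 / (r * q.re - 1) ≤ A) (hA : A < 1) (hG : G ∈ Resolvent.resolvents r q) :
    (∀ θ : ℝ, A < Real.cos θ →
      Resolvent.IsSpirallikeOfOrder θ
        ((Real.cos θ - A) / ((1 - A ^ 2) * Real.cos θ)) G) ∧
    Resolvent.IsStarlikeOfOrder (1 / (1 + A)) G ∧
    Resolvent.IsStronglyStarlikeOfOrder (2 / Real.pi * Real.arcsin A) G := by
  obtain ⟨p, hp, hp0, hGp⟩ := Resolvent.exists_isResolvent_of_mem_resolvents (by linarith) hG
  have hre : (p 0).re = r * q.re := by rw [hp0, Complex.re_ofReal_mul]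
  have hx3 : 3 ≤ (p 0).re := by
    have h2 := (div_lt_one (sub_pos.mpr hx)).mp (hxA.trans_lt hA)
    linarith
  have hquot : ∀ z ∈ Resolvent.disk, ‖(Resolvent.starQuotient G z)⁻¹ - 1‖ < A := fun z hz =>
    (hGp.norm_inv_starQuotient_sub_one_lt hp hx3 hz).trans_le (by rwa [hre])
  have huniv := hGp.isUnivalentZero hp hx3
  exact ⟨fun _ hθ => huniv.isSpirallikeOfOrder hA hquot hθ, huniv.isStarlikeOfOrder hA hquot,
    huniv.isStronglyStarlikeOfOrder hA hquot⟩

theorem mainTheorem3 (q : ℂ) (hq : 0 < q.re) (r : ℝ) (hr : Resolvent.r₀ < r * q.re)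
    (G : ℂ → ℂ) (hG : G ∈ Resolvent.resolvents r q) :
    (∀ θ : ℝ, |θ| ≤ Real.arccos (6 / (r * q.re)) →
      Resolvent.IsSpirallikeOfOrder θ
        ((Real.cos θ - Resolvent.funA (r * q.re)) /
          ((1 - Resolvent.funA (r * q.re) ^ 2) * Real.cos θ)) G) ∧
    Resolvent.IsStarlikeOfOrder (1 / (1 + Resolvent.funA (r * q.re))) G ∧
    Resolvent.IsStronglyStarlikeOfOrder
      (2 / Real.pi * Real.arcsin (Resolvent.funA (r * q.re))) G := by
  have h5 : 5 < r * q.re := Resolvent.five_le_r₀.trans_lt hr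
  obtain ⟨hspiral, hstar⟩ := mainTheorem3_general (by linarith)
    (Resolvent.two_div_sub_one_le_funA (by linarith)) (Resolvent.funA_lt_one hr) hG
  exact ⟨fun θ hθ => hspiral θ (Resolvent.funA_lt_cos hr hθ), hstar⟩
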